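/- Let $K$ be a field and $A$ an arbitrary (unital) associative $K$-algebra, of any dimension, with $A^*=\mathrm{Hom}_K(A,K)$. Grade $A\oplus A^*$ by the shifted degrees $|a|'=-1$ for $a\in A$ and $|f|'=0$ for $f\in A^*$, and equip it with the natural form $\langle f,a\rangle=f(a)=-\langle a,f\rangle$, $\langle a,b\rangle=\langle f,g\rangle=0$ ($a,b\in A$, $f,g\in A^*$). A pre-Calabi–Yau structure on $A$ is a family of multilinear operations $m_n\colon (A\oplus A^*)^{\otimes n}\to A\oplus A^*$ ($n\ge 1$) of degree $1$ such that, for all homogeneous arguments, (i) (Maurer–Cartan, i.e. $A_\infty$-structure) for every $k$, $$\sum_{p+q=k+1}\ \sum_{i=1}^{p}(-1)^{|x_1|'+\dots+|x_{i-1}|'}\,m_p\bigl(x_1,\dots,x_{i-1},m_q(x_i,\dots,x_{i+q-1}),x_{i+q},\dots,x_k\bigr)=0;$$ (ii) (cyclic invariance) $\langle m_n(x_1,\dots,x_n),x_{n+1}\rangle=(-1)^{|x_1|'(|x_2|'+\dots+|x_{n+1}|')}\langle m_n(x_2,\dots,x_{n+1}),x_1\rangle$; (iii) $A$ with its product is an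 $A_\infty$-subalgebra: $m_2(a,b)=ab$ and $m_n(a_1,\dots,a_n)=0$ for $n\neq 2$, for arguments in $A$. Suppose that $m_1=0$ and $m_4=0$, so that $m=\sum_{i\ge 2,\,i\ne 4}m_i$, and that $m$ is a restricted polyderivation on the ternary level: there is a linear map $\rho\colon A\otimes A\to A\otimes A$ that corresponds to the component $m_3\colon A\times A^*\times A\to A$ of $m_3$, i.e. $\langle g\otimes f,\rho(b\otimes a)\rangle=\langle m_3(a,f,b),g\rangle$ for all $a,b\in A$ and $f,g\in A^*$ (where $\langle g\otimes f,x\otimes y\rangle=g(x)f(y)$), and $\rho$ satisfies the Leibniz identities $$\rho(a\otimes bb')=b\cdot\rho(a\otimes b')+\rho(a\otimes b)\cdot b',\qquad \rho(aa'\otimes b)=a\star\rho(a'\otimes b)+\rho(a\otimes b)\star a',$$ with the outer actions $c\cdot(x\otimes y)=cx\otimes y$, $(x\otimes y)\cdot c=x\otimes yc$ and the inner actions $c\star(x\otimes y)=x\otimes cy$, $(x\otimes y)\star c=xc\otimes y$. Then for every $n$ the map $\rho$ induces a Poisson structure on the representation space $\mathrm{Rep}(A,n)$, i.e. on the commutative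 algebra generated by the matrix coefficients $a_{ij}$ ($a\in A$, $1\le i,j\le n$), linear in $a$, with relations $(ab)_{ij}=\sum_l a_{il}b_{lj}$ and $1_{ij}=\delta_{ij}$. That is, there is a bilinear, skew-symmetric bracket satisfying the Leibniz rule and the Jacobi identity, with $$\{a_{ij},b_{kl}\}=\sum x_{kj}\,y_{il}\qquad\text{whenever}\quad \rho(a\otimes b)=\sum x\otimes y .$$ This Poisson structure is $GL_n$-invariant: for every commutative $K$-algebra $R$, the action of $GL_n(R)$ by conjugation preserves the $R$-bilinear extension of the bracket. -/

import Mathlib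

open scoped TensorProduct

universe u v

noncomputable section

namespace PreCY

/-! ### A-infinity structures -/

/-- An `A_∞`-structure on a graded vector space `V = ⨁ d, 𝒱 d`, where `𝒱 d` is the piece of
*shifted* degree `d` (so `|x|' = d` for `x ∈ 𝒱 d`, and every operation has degree `1`).
The operations are `op 1, op 2, …`; there is no operation of arity `0`.

Finite families of inputs are written as sequences `x 0, x 1, …`, of which only the
first `k` terms matter. -/
structure AInfinity (K : Type u) [Field K] {V : Type v} [AddCommGroup V] [Module K V]
    (𝒱 : ℤ → Submodule K V) where
  /-- the operations `m_n : V^{⊗ n} → V` -/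
  op : (n : ℕ) → MultilinearMap K (fun _ : Fin n => V) V
  op_zero : op 0 = 0
  /-- every operation has degree one -/
  op_mem : ∀ (n : ℕ) (d : ℕ → ℤ) (x : ℕ → V), (∀ j, x j ∈ 𝒱 (d j)) →
    op n (fun j => x j) ∈ 𝒱 ((∑ j ∈ Finset.range n, d j) + 1)
  /-- the Maurer-Cartan equation in arity `k`: the sum over `p + q = k + 1` and `0 ≤ i < p` of
  `(-1)^(|x_0|' + ⋯ + |x_{i-1}|')` times
  `m_p (x_0, …, x_{i-1}, m_q (x_i, …, x_{i+q-1}), x_{i+q}, …, x_{k-1})` is zero -/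
  maurerCartan : ∀ (k : ℕ) (d : ℕ → ℤ) (x : ℕ → V), (∀ j, x j ∈ 𝒱 (d j)) →
    ∑ pq ∈ Finset.HasAntidiagonal.antidiagonal (k + 1), ∑ i ∈ Finset.range pq.1,
      Int.negOnePow (∑ j ∈ Finset.range i, d j) •
        op pq.1 (fun j : Fin pq.1 =>
          if (j : ℕ) < i then x j
          else if (j : ℕ) = i then op pq.2 (fun l : Fin pq.2 => x (i + l))
          else x (j - 1 + pq.2)) = 0

/-! ### Pre-Calabi-Yau structures on an associative algebra -/

section PreCalabiYau

variable (K : Type u) (A : Type v) [Field K] [Ring A] [Algebra K A]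

/-- The space `A ⊕ A^*`. -/
abbrev Double : Type (max u v) := A × Module.Dual K A

/-- The shifted grading of `A ⊕ A^*[-1]`: `A` sits in shifted degree `-1` and `A^*` in shifted
degree `0` (unshifted: `A` in degree `0`, `A^*` in degree `1`). -/
def grading (d : ℤ) : Submodule K (Double K A) :=
  if d = -1 then LinearMap.range (LinearMap.inl K A (Module.Dual K A))
  else if d = 0 then LinearMap.range (LinearMap.inr K A (Module.Dual K A))
  else ⊥

variable {K A}

/-- The natural inner form on `A ⊕ A^*`, with `⟨f, a⟩ = f a` and `⟨a, f⟩ = - f a`. It satisfies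
`⟨x, y⟩ = -(-1)^(|x|'|y|') ⟨y, x⟩`. -/
def pairing (x y : Double K A) : K := x.2 y.1 - y.2 x.1

variable (K A)

/-- A (`2`-)pre-Calabi-Yau structure on the associative algebra `A`: an `A_∞`-structure on
`A ⊕ A^*[-1]` which is cyclically invariant with respect to the natural inner form, and for which
`A`, with its product as the only operation, is an `A_∞`-subalgebra. -/
structure PreCalabiYau extends AInfinity K (grading K A) where
  cyclic : ∀ (n : ℕ) (d : ℕ → ℤ) (x : ℕ → Double K A), (∀ j, x j ∈ grading K A (d j)) →
    pairing (op n (fun j => x j)) (x n) =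
      Int.negOnePow (d 0 * ∑ j ∈ Finset.range n, d (j + 1)) •
        pairing (op n (fun j => x (j + 1))) (x 0)
  op_two_inl : ∀ a b : A, op 2 ![(a, 0), (b, 0)] = (a * b, 0)
  op_inl : ∀ (n : ℕ) (a : Fin n → A), n ≠ 2 → op n (fun j => (a j, 0)) = 0

variable {K A}

/-- `δ : A ⊗ A → A ⊗ A` is the linear map corresponding to the component
`m_3 : A × A^* × A → A` of type `B` of the pre-Calabi-Yau structure:
`⟨g ⊗ f, δ (b ⊗ a)⟩ = ⟨m_3 (a, f, b), g⟩`. -/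
def PreCalabiYau.Corresponds (m : PreCalabiYau K A) (δ : A ⊗[K] A →ₗ[K] A ⊗[K] A) : Prop :=
  ∀ (a b : A) (f g : Module.Dual K A),
    TensorProduct.dualDistrib K A A (g ⊗ₜ f) (δ (b ⊗ₜ a)) =
      pairing (m.op 3 ![(a, 0), (0, f), (b, 0)]) (0, g)

/-- `δ : A ⊗ A → A ⊗ A` is a polyderivation: it satisfies the Leibniz identity in both arguments.
The target `A ⊗ A` is the `A^{⊗ 2}`-bimodule whose second tensor factor acts by the outer structure
`b (x ⊗ y) = b x ⊗ y`, `(x ⊗ y) b = x ⊗ y b`, and whose first tensor factor acts by the inner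
structure `a ⋆ (x ⊗ y) = x ⊗ a y`, `(x ⊗ y) ⋆ a = x a ⊗ y`; these actions are written here through
the product of the algebra `A ⊗ A`. -/
structure IsPolyderivation (δ : A ⊗[K] A →ₗ[K] A ⊗[K] A) : Prop where
  leibniz_left : ∀ a a' b : A, δ ((a * a') ⊗ₜ b) =
    (1 ⊗ₜ a) * δ (a' ⊗ₜ b) + δ (a ⊗ₜ b) * (a' ⊗ₜ 1)
  leibniz_right : ∀ a b b' : A, δ (a ⊗ₜ (b * b')) =
    (b ⊗ₜ 1) * δ (a ⊗ₜ b') + δ (a ⊗ₜ b) * (1 ⊗ₜ b')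

/-- The pre-Calabi-Yau structure `m` is a restricted polyderivation on the ternary level, with
corresponding linear map `δ`. -/
structure PreCalabiYau.IsRestrictedPolyderivation (m : PreCalabiYau K A)
    (δ : A ⊗[K] A →ₗ[K] A ⊗[K] A) : Prop where
  corresponds : m.Corresponds δ
  isPolyderivation : IsPolyderivation δ

end PreCalabiYau

/-! ### Representation spaces -/

section Rep

variable (K : Type u) (A : Type v) [Field K] [Ring A] [Algebra K A] (n : ℕ)

/-- The relations between the matrix coefficients `a_{ij}` of an `n`-dimensional representation
of `A`. -/
inductive RepRel : MvPolynomial (A × Fin n × Fin n) K → Prop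
  | add (a b : A) (i j : Fin n) :
      RepRel (.X (a + b, i, j) - (.X (a, i, j) + .X (b, i, j)))
  | smul (c : K) (a : A) (i j : Fin n) :
      RepRel (.X (c • a, i, j) - .C c * .X (a, i, j))
  | mul (a b : A) (i j : Fin n) :
      RepRel (.X (a * b, i, j) - ∑ l : Fin n, .X (a, i, l) * .X (b, l, j))
  | one (i j : Fin n) :
      RepRel (.X (1, i, j) - if i = j then 1 else 0)

/-- The coordinate ring of the affine scheme `Rep(A, n)` of `n`-dimensional representations of
`A`: the commutative algebra generated by the symbols `a_{ij}`. -/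
abbrev RepRing : Type (max u v) :=
  MvPolynomial (A × Fin n × Fin n) K ⧸ Ideal.span {p | RepRel K A n p}

variable {A}

/-- The coordinate function `a_{ij}` on `Rep(A, n)`. -/
def coord (a : A) (i j : Fin n) : RepRing K A n := Ideal.Quotient.mk _ (.X (a, i, j))

variable {n}

theorem mk_eq_of_rel {p q : MvPolynomial (A × Fin n × Fin n) K} (h : RepRel K A n (p - q)) :
    (Ideal.Quotient.mk (Ideal.span {p | RepRel K A n p}) p) = Ideal.Quotient.mk _ q :=
  Ideal.Quotient.eq.2 (Ideal.subset_span h)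

theorem coord_add (a b : A) (i j : Fin n) :
    coord K n (a + b) i j = coord K n a i j + coord K n b i j := by
  simpa [coord] using mk_eq_of_rel K (.add a b i j)

theorem coord_smul (c : K) (a : A) (i j : Fin n) :
    coord K n (c • a) i j = c • coord K n a i j := by
  have h := mk_eq_of_rel K (RepRel.smul (n := n) c a i j)
  rw [← MvPolynomial.smul_eq_C_mul] at h
  exact h

theorem coord_mul (a b : A) (i j : Fin n) :
    coord K n (a * b) i j = ∑ l, coord K n a i l * coord K n b l j := by
  simpa [coord] using mk_eq_of_rel K (.mul a b i j)

theorem coord_one (i j : Fin n) :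
    coord K n (1 : A) i j = if i = j then 1 else 0 := by
  have h := mk_eq_of_rel K (RepRel.one (A := A) (K := K) i j)
  rw [coord, h]
  split_ifs <;> simp

/-- The coordinate function `a_{ij}`, as a linear function of `a`. -/
def coordₗ (i j : Fin n) : A →ₗ[K] RepRing K A n where
  toFun a := coord K n a i j
  map_add' a b := coord_add K a b i j
  map_smul' c a := coord_smul K c a i j

variable (A n)

/-- The universal `n`-dimensional representation `a ↦ (a_{ij})` of `A`. -/
def universalRep : A →ₐ[K] Matrix (Fin n) (Fin n) (RepRing K A n) :=
  AlgHom.ofLinearMap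
    { toFun := fun a => Matrix.of fun i j => coord K n a i j
      map_add' := fun a b => by ext i j; simp [coord_add]
      map_smul' := fun c a => by ext i j; simp [coord_smul] }
    (by ext i j; simp [coord_one, Matrix.one_apply])
    (fun a b => by ext i j; simp [coord_mul, Matrix.mul_apply])

variable {A n}

/-- A representation of `A` by `n × n` matrices over a commutative algebra `S` is a point of
`Rep(A, n)` with values in `S`. -/
def repLift {S : Type*} [CommRing S] [Algebra K S] (φ : A →ₐ[K] Matrix (Fin n) (Fin n) S) :
    RepRing K A n →ₐ[K] S :=
  Ideal.Quotient.liftₐ _ (MvPolynomial.aeval fun x => φ x.1 x.2.1 x.2.2) (by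
    intro p hp
    have h : Ideal.span {p | RepRel K A n p} ≤
        RingHom.ker (MvPolynomial.aeval (R := K) fun x : A × Fin n × Fin n =>
          φ x.1 x.2.1 x.2.2).toRingHom := by
      rw [Ideal.span_le]
      rintro q (⟨a, b, i, j⟩ | ⟨c, a, i, j⟩ | ⟨a, b, i, j⟩ | ⟨i, j⟩)
      · simp [RingHom.mem_ker]
      · have hs : φ (c • a) i j = c • φ a i j := by rw [map_smul]; rfl
        simp [RingHom.mem_ker, hs, ← Algebra.smul_def]
      · simp [RingHom.mem_ker, Matrix.mul_apply]
      · by_cases hij : i = j <;> simp [RingHom.mem_ker, hij]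
    exact h hp)

/-- Conjugation of a matrix representation by an invertible matrix. -/
def conjRep {S : Type*} [CommRing S] [Algebra K S] (g : GL (Fin n) S)
    (φ : A →ₐ[K] Matrix (Fin n) (Fin n) S) : A →ₐ[K] Matrix (Fin n) (Fin n) S :=
  AlgHom.ofLinearMap
    { toFun := fun a => g.1 * φ a * (g⁻¹).1
      map_add' := fun a b => by simp [mul_add, add_mul]
      map_smul' := fun c a => by simp }
    (by simp)
    (fun a b => by simp [mul_assoc])

/-- The action of `g ∈ GL_n(R)`, for a commutative `K`-algebra `R`, on functions on `Rep(A, n)`: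
the function `F` goes to the function `φ ↦ F (g φ g⁻¹)` on `Rep(A, n) × Spec R`. -/
def glAct {R : Type u} [CommRing R] [Algebra K R] (g : GL (Fin n) R) :
    RepRing K A n →ₐ[K] R ⊗[K] RepRing K A n :=
  repLift K (conjRep K
    (Matrix.GeneralLinearGroup.map (algebraMap R (R ⊗[K] RepRing K A n)) g)
    ((Algebra.TensorProduct.includeRight (R := K) (A := R)
      (B := RepRing K A n)).mapMatrix.comp (universalRep K A n)))

end Rep

/-! ### Poisson structures -/

/-- A Poisson structure on (the spectrum of) the commutative algebra `S`. -/
structure PoissonStructure (K : Type u) (S : Type v) [Field K] [CommRing S] [Algebra K S] where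
  bracket : S →ₗ[K] S →ₗ[K] S
  skew : ∀ F G, bracket F G = - bracket G F
  leibniz : ∀ F G H, bracket F (G * H) = bracket F G * H + G * bracket F H
  jacobi : ∀ F G H, bracket F (bracket G H) + bracket G (bracket H F) +
    bracket H (bracket F G) = 0

section Induced

variable {K : Type u} {A : Type v} [Field K] [Ring A] [Algebra K A] {n : ℕ}

/-- The Poisson structure on `Rep(A, n)` is the one induced by `δ : A ⊗ A → A ⊗ A`: if
`δ (a ⊗ b) = ∑ x ⊗ y` then `{a_{ij}, b_{kl}} = ∑ x_{kj} y_{il}`. -/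
def PoissonStructure.IsInducedBy (P : PoissonStructure K (RepRing K A n))
    (δ : A ⊗[K] A →ₗ[K] A ⊗[K] A) : Prop :=
  ∀ (a b : A) (i j k l : Fin n),
    P.bracket (coord K n a i j) (coord K n b k l) =
      LinearMap.mul' K (RepRing K A n)
        (TensorProduct.map (coordₗ K k j) (coordₗ K i l) (δ (a ⊗ₜ b)))

/-- The Poisson structure is invariant under the group scheme `GL_n`: for every commutative
`K`-algebra `R` and `g ∈ GL_n(R)`, the action of `g` preserves the bracket (extended
`R`-bilinearly). The case `R = K` is invariance under the group `GL_n(K)`. -/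
def PoissonStructure.IsGLInvariant (P : PoissonStructure K (RepRing K A n)) : Prop :=
  ∀ (R : Type u) [CommRing R] [Algebra K R] (g : GL (Fin n) R) (F G : RepRing K A n),
    glAct K g (P.bracket F G) =
      LinearMap.BilinMap.baseChange R P.bracket (glAct K g F) (glAct K g G)

end Induced

end PreCY

end

/-! The map `ρ` is a double Poisson bracket, and such a bracket induces a Poisson bracket on every
representation space.

Skew-symmetry of `ρ` is cyclicity of `m_3`: two rotations carry `⟨m_3(a,f,b),g⟩` to
`-⟨m_3(b,g,a),f⟩`. The double Jacobi identity is the Maurer–Cartan equation in arity 5 on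
`(c,f,b,g,a)`: since `m_1 = m_4 = 0`, only the compositions of `m_3` with itself survive, and
cyclicity expresses the component `A^* × A × A^* → A^*` by `ρ` as well. Over a field, products of
linear forms separate tensors, so these scalar identities lift to `A ⊗ A` and `A ⊗ A ⊗ A` in any
dimension.

On `Rep(A,n)`, the outer and inner Leibniz identities say that the formula on matrix coefficients
respects `(ab)_{ij} = ∑ a_{il} b_{lj}` in each argument. The bracket is therefore built as a
derivation with values in derivations (`exists_derivation_coord`, used twice). Its Jacobiator is a
derivation in each argument, hence determined on generators, where it is the difference of two
evaluations of the double Jacobi identity. Invariance is likewise checked on generators, because the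
base-changed bracket is still a biderivation. -/

namespace PreCY

/-! ### Ternary operations on homogeneous elements: degree, cyclicity, arity-5 equation. -/

section Operations

variable {K : Type u} {A : Type v} [Field K] [Ring A] [Algebra K A]

theorem inl_mem_grading (a : A) : ((a, 0) : Double K A) ∈ grading K A (-1) := by
  simp [grading]

theorem inr_mem_grading (f : Module.Dual K A) : ((0, f) : Double K A) ∈ grading K A 0 := by
  simp [grading]

theorem eq_inl_of_mem_grading {x : Double K A} (hx : x ∈ grading K A (-1)) : x = (x.1, 0) := by
  simp only [grading, if_true, LinearMap.mem_range] at hx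
  obtain ⟨a, rfl⟩ := hx
  simp

theorem eq_inr_of_mem_grading {x : Double K A} (hx : x ∈ grading K A 0) : x = (0, x.2) := by
  simp [grading] at hx
  obtain ⟨a, rfl⟩ := hx
  simp

/-- The axioms of `AInfinity` take infinite sequences. A finite list is padded by `0`, placed in
degree `0`, which is harmless because zero lies in every graded piece. -/
theorem getD_mem_grading (x : List (Double K A)) (d : List ℤ)
    (h : List.Forall₂ (fun y e => y ∈ grading K A e) x d) (j : ℕ) :
    x.getD j 0 ∈ grading K A (d.getD j 0) := by
  induction h generalizing j with
  | nil => simp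
  | cons h _ ih => cases j with
    | zero => simpa using h
    | succ j => simpa using ih j

theorem AInfinity.op_three_mem (m : AInfinity K (grading K A)) {x y z : Double K A} {p q r : ℤ}
    (hx : x ∈ grading K A p) (hy : y ∈ grading K A q) (hz : z ∈ grading K A r) :
    m.op 3 ![x, y, z] ∈ grading K A (p + q + r + 1) := by
  have h := m.op_mem 3 (fun j => [p, q, r].getD j 0) (fun j => [x, y, z].getD j 0)
    (getD_mem_grading _ _ (by simp [hx, hy, hz]))
  have e : (fun j : Fin 3 => [x, y, z].getD (j : ℕ) 0) = ![x, y, z] := by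
    funext j; fin_cases j <;> rfl
  rw [e] at h
  simpa [Finset.sum_range_succ] using h

theorem PreCalabiYau.cyclic_three (m : PreCalabiYau K A) {x y z w : Double K A} {p q r s : ℤ}
    (hx : x ∈ grading K A p) (hy : y ∈ grading K A q) (hz : z ∈ grading K A r)
    (hw : w ∈ grading K A s) :
    pairing (m.op 3 ![x, y, z]) w =
      Int.negOnePow (p * (q + r + s)) • pairing (m.op 3 ![y, z, w]) x := by
  have h := m.cyclic 3 (fun j => [p, q, r, s].getD j 0) (fun j => [x, y, z, w].getD j 0)
    (getD_mem_grading _ _ (by simp [hx, hy, hz, hw]))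
  have e : (fun j : Fin 3 => [x, y, z, w].getD (j : ℕ) 0) = ![x, y, z] := by
    funext j; fin_cases j <;> rfl
  have e' : (fun j : Fin 3 => [x, y, z, w].getD ((j : ℕ) + 1) 0) = ![y, z, w] := by
    funext j; fin_cases j <;> rfl
  rw [e, e'] at h
  simpa [Finset.sum_range_succ] using h

theorem AInfinity.maurerCartan_five (m : AInfinity K (grading K A)) (h1 : m.op 1 = 0)
    (h4 : m.op 4 = 0) {x y z w t : Double K A} {p q r s e : ℤ}
    (hx : x ∈ grading K A p) (hy : y ∈ grading K A q) (hz : z ∈ grading K A r)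
    (hw : w ∈ grading K A s) (ht : t ∈ grading K A e) :
    m.op 3 ![m.op 3 ![x, y, z], w, t] + Int.negOnePow p • m.op 3 ![x, m.op 3 ![y, z, w], t] +
      Int.negOnePow (p + q) • m.op 3 ![x, y, m.op 3 ![z, w, t]] = 0 := by
  set X : ℕ → Double K A := fun j => [x, y, z, w, t].getD j 0
  have h := m.maurerCartan 5 (fun j => [p, q, r, s, e].getD j 0) X
    (getD_mem_grading _ _ (by simp [hx, hy, hz, hw, ht]))
  have inner : ∀ k l : ℕ, m.op l = 0 → ∀ i ∈ Finset.range k,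
      Int.negOnePow (∑ j ∈ Finset.range i, [p, q, r, s, e].getD j 0) •
        m.op k (fun j : Fin k =>
          if (j : ℕ) < i then X j
          else if (j : ℕ) = i then m.op l (fun b : Fin l => X (i + b))
          else X (j - 1 + l)) = 0 := by
    intro k l hl i hi
    rw [(m.op k).map_coord_zero ⟨i, Finset.mem_range.1 hi⟩ (by simp [hl]), smul_zero]
  rw [show Finset.HasAntidiagonal.antidiagonal (5 + 1) =
    {(0, 6), (1, 5), (2, 4), (3, 3), (4, 2), (5, 1), (6, 0)} by rfl] at h
  simp only [Finset.sum_insert, Finset.sum_singleton, Finset.mem_insert, Finset.mem_singleton,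
    Prod.mk.injEq, Nat.reduceEqDiff, reduceCtorEq, and_self,
    or_self, not_false_eq_true, zero_ne_one, OfNat.zero_ne_ofNat, OfNat.one_ne_ofNat] at h
  rw [Finset.sum_eq_zero (inner 2 4 h4), Finset.sum_eq_zero (inner 5 1 h1),
    Finset.sum_eq_zero (inner 6 0 m.op_zero)] at h
  simp only [h1, h4, zero_apply, smul_zero, Finset.sum_const_zero, zero_add,
    add_zero, Finset.range_zero, Finset.sum_empty] at h
  simp only [Finset.sum_range_succ, Finset.range_zero, Finset.sum_empty, zero_add] at h
  have e0 : (fun l : Fin 3 => X l) = ![x, y, z] := by funext j; fin_cases j <;> rfl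
  have e1 : (fun l : Fin 3 => X (1 + l)) = ![y, z, w] := by funext j; fin_cases j <;> rfl
  have e2 : (fun l : Fin 3 => X (2 + l)) = ![z, w, t] := by funext j; fin_cases j <;> rfl
  rw [e0, e1, e2] at h
  have f0 : ∀ c, (fun j : Fin 3 => if (j : ℕ) < 0 then X j else if (j : ℕ) = 0 then c
      else X (j - 1 + 3)) = ![c, w, t] := by intro c; funext j; fin_cases j <;> rfl
  have f1 : ∀ c, (fun j : Fin 3 => if (j : ℕ) < 1 then X j else if (j : ℕ) = 1 then c
      else X (j - 1 + 3)) = ![x, c, t] := by intro c; funext j; fin_cases j <;> rfl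
  have f2 : ∀ c, (fun j : Fin 3 => if (j : ℕ) < 2 then X j else if (j : ℕ) = 2 then c
      else X (j - 1 + 3)) = ![x, y, c] := by intro c; funext j; fin_cases j <;> rfl
  rw [f0, f1, f2] at h
  simpa using h

end Operations

/-! ### Evaluating tensors on linear forms. -/

section Tensors

variable {K : Type u} {A : Type v} [Field K] [Ring A] [Algebra K A]
variable {S : Type*} [CommRing S] [Algebra K S]

/-- The product of two linear forms with values in a commutative algebra. -/
noncomputable def tensorEval (f g : A →ₗ[K] S) : A ⊗[K] A →ₗ[K] S :=
  LinearMap.mul' K S ∘ₗ TensorProduct.map f g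

/-- The product of three linear forms with values in a commutative algebra. -/
noncomputable def tensorEval₃ (f g h : A →ₗ[K] S) : (A ⊗[K] A) ⊗[K] A →ₗ[K] S :=
  LinearMap.mul' K S ∘ₗ TensorProduct.map (tensorEval f g) h

@[simp] theorem tensorEval_tmul (f g : A →ₗ[K] S) (a b : A) :
    tensorEval f g (a ⊗ₜ b) = f a * g b := by simp [tensorEval]

@[simp] theorem tensorEval₃_tmul (f g h : A →ₗ[K] S) (t : A ⊗[K] A) (c : A) :
    tensorEval₃ f g h (t ⊗ₜ c) = tensorEval f g t * h c := by simp [tensorEval₃]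

theorem tensorEval_comm (f g : A →ₗ[K] S) (t : A ⊗[K] A) :
    tensorEval f g (TensorProduct.comm K A A t) = tensorEval g f t := by
  induction t with
  | zero => simp
  | tmul x y => simp [mul_comm]
  | add s t hs ht => simp [hs, ht]

theorem dualDistrib_eq_tensorEval (f g : Module.Dual K A) (t : A ⊗[K] A) :
    TensorProduct.dualDistrib K A A (f ⊗ₜ g) t = tensorEval f g t := by
  induction t with
  | zero => simp
  | tmul x y => simp
  | add s t hs ht => simp [hs, ht]

/-- The coordinates of `t` in the product of a basis of `A` with itself are values of products of
coordinate forms, so no finiteness of `A` is needed. -/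
theorem eq_zero_of_tensorEval (t : A ⊗[K] A)
    (h : ∀ f g : Module.Dual K A, tensorEval f g t = 0) : t = 0 := by
  let e := Module.Basis.ofVectorSpace K A
  have key : ∀ i j (s : A ⊗[K] A), (e.tensorProduct e).repr s (i, j) =
      tensorEval (e.coord i) (e.coord j) s := by
    intro i j s
    induction s with
    | zero => simp
    | tmul x y => simp [mul_comm]
    | add s t hs ht => simp [hs, ht]
  refine (e.tensorProduct e).ext_elem fun ⟨i, j⟩ => ?_
  rw [key, h, map_zero]; rfl

theorem eq_zero_of_tensorEval₃ (t : (A ⊗[K] A) ⊗[K] A)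
    (h : ∀ f g k : Module.Dual K A, tensorEval₃ f g k t = 0) : t = 0 := by
  let e := Module.Basis.ofVectorSpace K A
  have key₂ : ∀ i j (s : A ⊗[K] A), (e.tensorProduct e).repr s (i, j) =
      tensorEval (e.coord i) (e.coord j) s := by
    intro i j s
    induction s with
    | zero => simp
    | tmul x y => simp [mul_comm]
    | add s t hs ht => simp [hs, ht]
  have key : ∀ i j k (s : (A ⊗[K] A) ⊗[K] A),
      ((e.tensorProduct e).tensorProduct e).repr s ((i, j), k) =
      tensorEval₃ (e.coord i) (e.coord j) (e.coord k) s := by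
    intro i j k s
    induction s with
    | zero => simp
    | tmul x y => simp [key₂, mul_comm]
    | add s t hs ht => simp [hs, ht]
  refine ((e.tensorProduct e).tensorProduct e).ext_elem fun ⟨⟨i, j⟩, k⟩ => ?_
  rw [key, h, map_zero]; rfl

variable (K A) in
/-- The cyclic permutation `x ⊗ y ⊗ z ↦ z ⊗ x ⊗ y`. -/
noncomputable def rotate : (A ⊗[K] A) ⊗[K] A →ₗ[K] (A ⊗[K] A) ⊗[K] A :=
  (TensorProduct.assoc K A A A).symm.toLinearMap ∘ₗ
    (TensorProduct.comm K (A ⊗[K] A) A).toLinearMap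

theorem tensorEval₃_rotate (f g h : A →ₗ[K] S) (t : (A ⊗[K] A) ⊗[K] A) :
    tensorEval₃ f g h (rotate K A t) = tensorEval₃ g h f t := by
  induction t with
  | zero => simp
  | tmul s c =>
    induction s with
    | zero => simp
    | tmul x y => simp [rotate]; ring
    | add s t hs ht => simp only [TensorProduct.add_tmul, map_add, hs, ht]
  | add s t hs ht => simp [hs, ht]

/-- `a ⊗ x ⊗ y ↦ ρ (a ⊗ x) ⊗ y`. -/
noncomputable def extendLeft (ρ : A ⊗[K] A →ₗ[K] A ⊗[K] A) (a : A) :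
    A ⊗[K] A →ₗ[K] (A ⊗[K] A) ⊗[K] A :=
  (ρ ∘ₗ TensorProduct.mk K A A a).rTensor A

@[simp] theorem extendLeft_tmul (ρ : A ⊗[K] A →ₗ[K] A ⊗[K] A) (a x y : A) :
    extendLeft ρ a (x ⊗ₜ y) = ρ (a ⊗ₜ x) ⊗ₜ y := by simp [extendLeft]

/-- The contraction of the second tensor factor with a linear form. -/
noncomputable def contractRight (f : Module.Dual K A) : A ⊗[K] A →ₗ[K] A :=
  (TensorProduct.rid K A).toLinearMap ∘ₗ f.lTensor A

@[simp] theorem contractRight_tmul (f : Module.Dual K A) (x y : A) :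
    contractRight f (x ⊗ₜ y) = f y • x := by simp [contractRight]

theorem apply_contractRight (f g : Module.Dual K A) (t : A ⊗[K] A) :
    g (contractRight f t) = tensorEval g f t := by
  induction t with
  | zero => simp
  | tmul x y => simp [mul_comm]
  | add s t hs ht => simp [hs, ht]

theorem tensorEval_apply_contractRight (ρ : A ⊗[K] A →ₗ[K] A ⊗[K] A) (a : A)
    (f g h : Module.Dual K A) (t : A ⊗[K] A) :
    tensorEval f g (ρ (a ⊗ₜ contractRight h t)) = tensorEval₃ f g h (extendLeft ρ a t) := by
  induction t with
  | zero => simp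
  | tmul x y => simp [mul_comm]
  | add s t hs ht => simp only [map_add, TensorProduct.tmul_add, hs, ht]

end Tensors

/-! ### From the pre-Calabi–Yau structure to a double Poisson bracket. -/

section DoubleBracket

variable {K : Type u} {A : Type v} [Field K] [Ring A] [Algebra K A]

/-- Two cyclic rotations exchange the roles of `(a, f)` and `(b, g)`. Moving `a` past arguments of
total degree `-1` gives the sign `-1`; moving `f`, of degree `0`, gives none. -/
theorem PreCalabiYau.Corresponds.skew {m : PreCalabiYau K A} {ρ : A ⊗[K] A →ₗ[K] A ⊗[K] A}
    (hρ : m.Corresponds ρ) (a b : A) :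
    ρ (b ⊗ₜ a) = -TensorProduct.comm K A A (ρ (a ⊗ₜ b)) := by
  rw [← add_eq_zero_iff_eq_neg]
  refine eq_zero_of_tensorEval _ fun g f => ?_
  rw [map_add, tensorEval_comm, ← dualDistrib_eq_tensorEval, ← dualDistrib_eq_tensorEval,
    hρ, hρ, m.cyclic_three (inl_mem_grading a) (inr_mem_grading f) (inl_mem_grading b)
      (inr_mem_grading g), m.cyclic_three (inr_mem_grading f) (inl_mem_grading b)
      (inr_mem_grading g) (inl_mem_grading a)]
  simp

/-- The output has degree `-1`, so it lies in `A` and is determined by its pairings with `A^*`. The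
minus sign comes from `⟨a, g⟩ = -g a`. -/
theorem PreCalabiYau.Corresponds.op_inl_inr_inl {m : PreCalabiYau K A}
    {ρ : A ⊗[K] A →ₗ[K] A ⊗[K] A} (hρ : m.Corresponds ρ) (a b : A) (f : Module.Dual K A) :
    m.op 3 ![(a, 0), (0, f), (b, 0)] = (-contractRight f (ρ (b ⊗ₜ a)), 0) := by
  have h := eq_inl_of_mem_grading (m.op_three_mem (inl_mem_grading a) (inr_mem_grading f)
    (inl_mem_grading b))
  rw [h]
  congr 1
  rw [eq_neg_iff_add_eq_zero, ← Module.forall_dual_apply_eq_zero_iff K]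
  intro g
  rw [map_add, apply_contractRight, ← dualDistrib_eq_tensorEval, hρ]
  simp [pairing]

/-- The output has degree `0`, so it is a linear form; its value at `a` is found by rotating `a` to
the front. -/
theorem PreCalabiYau.Corresponds.op_inr_inl_inr {m : PreCalabiYau K A}
    {ρ : A ⊗[K] A →ₗ[K] A ⊗[K] A} (hρ : m.Corresponds ρ) (b : A) (f g : Module.Dual K A) :
    m.op 3 ![(0, f), (b, 0), (0, g)] =
      (0, -(tensorEval g f ∘ₗ ρ ∘ₗ TensorProduct.mk K A A b)) := by
  have h := eq_inr_of_mem_grading (m.op_three_mem (inr_mem_grading f) (inl_mem_grading b)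
    (inr_mem_grading g))
  rw [h]
  congr 1
  ext a
  have h2 := m.cyclic_three (inl_mem_grading a) (inr_mem_grading f) (inl_mem_grading b)
      (inr_mem_grading g)
  rw [← hρ, dualDistrib_eq_tensorEval] at h2
  simp [pairing] at h2
  simp [h2]

/-- The double Jacobi identity. -/
theorem PreCalabiYau.Corresponds.jacobi {m : PreCalabiYau K A} (h1 : m.op 1 = 0)
    (h4 : m.op 4 = 0) {ρ : A ⊗[K] A →ₗ[K] A ⊗[K] A} (hρ : m.Corresponds ρ) (a b c : A) :
    extendLeft ρ a (ρ (b ⊗ₜ c)) + rotate K A (extendLeft ρ b (ρ (c ⊗ₜ a))) +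
      rotate K A (rotate K A (extendLeft ρ c (ρ (a ⊗ₜ b)))) = 0 := by
  refine eq_zero_of_tensorEval₃ _ fun h g f => ?_
  have key := m.maurerCartan_five h1 h4 (inl_mem_grading c) (inr_mem_grading f)
    (inl_mem_grading b) (inr_mem_grading g) (inl_mem_grading a)
  simp only [hρ.op_inl_inr_inl, hρ.op_inr_inl_inr] at key
  have key2 := congrArg (fun x : Double K A => h x.1) key
  -- The inner form `m_3(f,b,g)` contracts the second factor of `ρ (a ⊗ c)`, whereas `extendLeft`
  -- acts on the first; hence the flip.
  have middle : ∀ t : A ⊗[K] A, tensorEval h (tensorEval g f ∘ₗ ρ ∘ₗ TensorProduct.mk K A A b) t =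
      tensorEval₃ g f h (extendLeft ρ b (TensorProduct.comm K A A t)) := by
    intro t
    induction t with
    | zero => simp
    | tmul x y => simp [mul_comm]
    | add s t hs ht => simp only [map_add, hs, ht]
  have neg_right : ∀ t : A ⊗[K] A, tensorEval h
      (-(tensorEval g f ∘ₗ ρ ∘ₗ TensorProduct.mk K A A b)) t =
      -tensorEval h (tensorEval g f ∘ₗ ρ ∘ₗ TensorProduct.mk K A A b) t := by
    intro t
    induction t with
    | zero => simp
    | tmul x y => simp
    | add s t hs ht => simp only [map_add, hs, ht]; ring
  -- In `m_3(c, f, m_3(b,g,a))` the inner result enters the first slot of `ρ`. Skew-symmetry moves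
  -- it to the second, the slot used by `extendLeft`.
  simp only [Prod.fst_add, map_add, map_neg, apply_contractRight, TensorProduct.tmul_neg,
    neg_neg, tensorEval_apply_contractRight, Prod.fst_neg, map_zero, Prod.fst_zero,
    Int.negOnePow_neg, Int.negOnePow_one, Units.neg_smul, one_smul, add_zero, neg_right,
    hρ.skew c (-contractRight g (ρ (a ⊗ₜ b))), tensorEval_comm, middle] at key2
  rw [map_add, map_add, tensorEval₃_rotate, tensorEval₃_rotate, tensorEval₃_rotate,
    hρ.skew a c]
  rw [← key2]
  simp

end DoubleBracket

end PreCY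

namespace PreCY

/-! ### Derivations of the coordinate ring of `Rep(A, n)`. -/

section Derivations

variable {K : Type u} {A : Type v} [Field K] [Ring A] [Algebra K A] {n : ℕ}

variable (K A n) in
theorem adjoin_coord_eq_top :
    Algebra.adjoin K (Set.range fun x : A × Fin n × Fin n => coord K n x.1 x.2.1 x.2.2) = ⊤ := by
  have h := congrArg (Subalgebra.map (Ideal.Quotient.mkₐ K
    (Ideal.span {p | RepRel K A n p}))) (MvPolynomial.adjoin_range_X (R := K)
      (σ := A × Fin n × Fin n))
  rw [AlgHom.map_adjoin, ← Set.range_comp, Algebra.map_top,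
    (AlgHom.range_eq_top _).2 (Ideal.Quotient.mkₐ_surjective K _)] at h
  exact h

theorem derivation_ext_coord {M : Type*} [AddCommGroup M] [Module K M] [Module (RepRing K A n) M]
    {d e : Derivation K (RepRing K A n) M}
    (h : ∀ a i j, d (coord K n a i j) = e (coord K n a i j)) : d = e :=
  Derivation.ext_of_adjoin_eq_top _ (adjoin_coord_eq_top K A n) (by
    rintro _ ⟨x, rfl⟩; exact h _ _ _)

/-- A derivation of the coordinate ring of `Rep(A, n)` may be prescribed on the matrix
coefficients, as long as the values are compatible with the product of `A`. -/
theorem exists_derivation_coord {M : Type*} [AddCommGroup M] [Module K M]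
    [Module (RepRing K A n) M] [IsScalarTower K (RepRing K A n) M]
    (D : Fin n → Fin n → A →ₗ[K] M)
    (hD : ∀ a b i j, D i j (a * b) =
      ∑ l, (coord K n a i l • D l j b + coord K n b l j • D i l a)) :
    ∃ d : Derivation K (RepRing K A n) M, ∀ a i j, d (coord K n a i j) = D i j a := by
  let I : Ideal (MvPolynomial (A × Fin n × Fin n) K) := Ideal.span {p | RepRel K A n p}
  let _ : Module (MvPolynomial (A × Fin n × Fin n) K) M := Module.compHom M (Ideal.Quotient.mk I)
  have smul_def : ∀ (p : MvPolynomial (A × Fin n × Fin n) K) (x : M),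
      p • x = Ideal.Quotient.mk I p • x := fun _ _ => rfl
  have : IsScalarTower K (MvPolynomial (A × Fin n × Fin n) K) M := ⟨fun c p x => by
    rw [smul_def, smul_def, ← smul_assoc]; rfl⟩
  let d₀ : Derivation K (MvPolynomial (A × Fin n × Fin n) K) M :=
    MvPolynomial.mkDerivation K fun x => D x.2.1 x.2.2 x.1
  have d₀_X : ∀ a i j, d₀ (.X (a, i, j)) = D i j a := fun a i j =>
    MvPolynomial.mkDerivation_X K _ _
  have mk_X : ∀ a i j, Ideal.Quotient.mk I (.X (a, i, j)) = coord K n a i j := fun _ _ _ => rfl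
  -- Compatibility at `1 * 1` reads `D 1 = D 1 + D 1`, so the unit relation needs no separate
  -- hypothesis.
  have D_one : ∀ i j, D i j 1 = 0 := by
    intro i j
    have coord_one_smul : ∀ i j (x : M), coord K n (1 : A) i j • x = if i = j then x else 0 := by
      intro i j x
      rw [coord_one]
      split_ifs
      exacts [one_smul _ x, zero_smul (RepRing K A n) x]
    have h := hD 1 1 i j
    simp only [mul_one, coord_one_smul, Finset.sum_add_distrib] at h
    simpa using h
  have d₀_rel : ∀ p, RepRel K A n p → d₀ p = 0 := by
    rintro _ (⟨a, b, i, j⟩ | ⟨c, a, i, j⟩ | ⟨a, b, i, j⟩ | ⟨i, j⟩)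
    · simp [d₀_X]
    · rw [← MvPolynomial.smul_eq_C_mul]
      simp [d₀_X]
    · simp only [map_sub, map_sum, Derivation.leibniz, d₀_X, smul_def, mk_X, hD, sub_self]
    · split_ifs <;> simp [d₀_X, D_one]
  have d₀_ideal : I.restrictScalars K ≤ LinearMap.ker (d₀ : _ →ₗ[K] M) := by
    intro p hp
    rw [LinearMap.mem_ker, Derivation.coeFn_coe]
    refine Submodule.span_induction (p := fun p _ => d₀ p = 0) (fun p hp => d₀_rel p hp)
      (map_zero _) (fun p q _ _ hp hq => by rw [map_add, hp, hq, add_zero]) ?_ hp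
    -- In the Leibniz expansion of `p * q` one term contains `d₀ q = 0`; in the other `q ∈ I` acts
    -- by zero, because `M` is a module over the quotient.
    intro p q hq hq0
    have hq' : Ideal.Quotient.mk I q = 0 := Ideal.Quotient.eq_zero_iff_mem.2 hq
    rw [smul_eq_mul, Derivation.leibniz, hq0, smul_zero, smul_def, hq', zero_add]
    exact zero_smul (RepRing K A n) (d₀ p)
  let d₁ : RepRing K A n →ₗ[K] M := (I.restrictScalars K).liftQ (d₀ : _ →ₗ[K] M) d₀_ideal
  have d₁_mk : ∀ p, d₁ (Ideal.Quotient.mk I p) = d₀ p := fun p =>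
    (I.restrictScalars K).liftQ_apply _ p
  refine ⟨Derivation.mk' d₁ ?_, fun a i j => ?_⟩
  · intro F G
    obtain ⟨p, rfl⟩ := Ideal.Quotient.mk_surjective F
    obtain ⟨q, rfl⟩ := Ideal.Quotient.mk_surjective G
    rw [← map_mul, d₁_mk, d₁_mk, d₁_mk, Derivation.leibniz]
    rfl
  · exact (d₁_mk _).trans (d₀_X a i j)

end Derivations

/-! ### The induced bracket and its Jacobi identity. -/

section Bracket

variable {K : Type u} {A : Type v} [Field K] [Ring A] [Algebra K A] {n : ℕ}
variable {S : Type*} [CommRing S] [Algebra K S]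

/-- The evaluation of derivations of `S` at a fixed element of `S`. -/
def evalDerivation (F : S) : Derivation K S S →ₗ[S] S where
  toFun e := e F
  map_add' _ _ := rfl
  map_smul' _ _ := rfl

theorem sum_derivation_apply {ι : Type*} (s : Finset ι) (e : ι → Derivation K S S) (F : S) :
    (∑ i ∈ s, e i) F = ∑ i ∈ s, e i F :=
  map_sum (evalDerivation F) e s

theorem coordₗ_apply (i j : Fin n) (a : A) : coordₗ K i j a = coord K n a i j := rfl

/-- The function `∑ x_{ij} y_{kl}` on `Rep(A, n)` defined by a tensor `∑ x ⊗ y`. -/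
noncomputable abbrev coordEval (i j k l : Fin n) : A ⊗[K] A →ₗ[K] RepRing K A n :=
  tensorEval (coordₗ K i j) (coordₗ K k l)

/-- In the pattern `x_{kj} y_{il}` of `{a_{ij}, b_{kl}}`, the outer actions change `k` and `l`, the
indices of `b`, and the inner actions change `i` and `j`, the indices of `a`. This and the next
three lemmas thus turn each Leibniz identity into the matrix product rule in the corresponding
argument. -/
theorem coordEval_left_mul (b : A) (t : A ⊗[K] A) (i j k l : Fin n) :
    coordEval i j k l ((b ⊗ₜ 1) * t) = ∑ p, coord K n b i p * coordEval p j k l t := by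
  induction t with
  | zero => simp
  | tmul x y => simp [coordₗ_apply, coord_mul, Finset.sum_mul, mul_assoc]
  | add s t hs ht => simp only [mul_add, map_add, hs, ht, Finset.sum_add_distrib]

theorem coordEval_right_mul (b : A) (t : A ⊗[K] A) (i j k l : Fin n) :
    coordEval i j k l (t * (1 ⊗ₜ b)) = ∑ p, coord K n b p l * coordEval i j k p t := by
  induction t with
  | zero => simp
  | tmul x y =>
    simp only [Algebra.TensorProduct.tmul_mul_tmul, mul_one, tensorEval_tmul, coordₗ_apply,
      coord_mul, Finset.mul_sum]
    exact Finset.sum_congr rfl fun p _ => by ring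
  | add s t hs ht => simp only [mul_add, add_mul, map_add, hs, ht, Finset.sum_add_distrib]

theorem coordEval_inner_left_mul (b : A) (t : A ⊗[K] A) (i j k l : Fin n) :
    coordEval i j k l ((1 ⊗ₜ b) * t) = ∑ p, coord K n b k p * coordEval i j p l t := by
  induction t with
  | zero => simp
  | tmul x y =>
    simp only [Algebra.TensorProduct.tmul_mul_tmul, one_mul, tensorEval_tmul, coordₗ_apply,
      coord_mul, Finset.mul_sum]
    exact Finset.sum_congr rfl fun p _ => by ring
  | add s t hs ht => simp only [mul_add, map_add, hs, ht, Finset.sum_add_distrib]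

theorem coordEval_inner_right_mul (b : A) (t : A ⊗[K] A) (i j k l : Fin n) :
    coordEval i j k l (t * (b ⊗ₜ 1)) = ∑ p, coord K n b p j * coordEval i p k l t := by
  induction t with
  | zero => simp
  | tmul x y =>
    simp only [Algebra.TensorProduct.tmul_mul_tmul, mul_one, tensorEval_tmul, coordₗ_apply,
      coord_mul, Finset.sum_mul]
    exact Finset.sum_congr rfl fun p _ => by ring
  | add s t hs ht => simp only [add_mul, mul_add, map_add, hs, ht, Finset.sum_add_distrib]

theorem IsPolyderivation.exists_hamiltonian {ρ : A ⊗[K] A →ₗ[K] A ⊗[K] A}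
    (hρ : IsPolyderivation ρ) (a : A) (i j : Fin n) :
    ∃ d : Derivation K (RepRing K A n) (RepRing K A n), ∀ b k l,
      d (coord K n b k l) = coordEval k j i l (ρ (a ⊗ₜ b)) := by
  refine exists_derivation_coord (fun k l => coordEval k j i l ∘ₗ ρ ∘ₗ TensorProduct.mk K A A a) ?_
  intro b c k l
  simp only [LinearMap.comp_apply, TensorProduct.mk_apply, hρ.leibniz_right, map_add,
    coordEval_left_mul, coordEval_right_mul, Finset.sum_add_distrib, smul_eq_mul]

/-- A polyderivation of `A` induces a biderivation of the coordinate ring of `Rep(A, n)`. -/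
theorem IsPolyderivation.exists_biderivation {ρ : A ⊗[K] A →ₗ[K] A ⊗[K] A}
    (hρ : IsPolyderivation ρ) (n : ℕ) :
    ∃ d : Derivation K (RepRing K A n) (Derivation K (RepRing K A n) (RepRing K A n)),
      ∀ a b i j k l, d (coord K n a i j) (coord K n b k l) =
        coordEval k j i l (ρ (a ⊗ₜ b)) := by
  choose H hH using fun (a : A) (i j : Fin n) => hρ.exists_hamiltonian a i j
  -- The module is now the space of derivations of the coordinate ring. The identities required of
  -- the `H a i j` are equalities of derivations, hence checked on matrix coefficients.
  obtain ⟨d, hd⟩ := exists_derivation_coord (K := K) (n := n)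
    (fun i j =>
      { toFun := fun a => H a i j
        map_add' := fun a b => derivation_ext_coord fun c k l => by
          simp [hH, TensorProduct.add_tmul]
        map_smul' := fun c a => derivation_ext_coord fun b k l => by
          simp only [hH, RingHom.id_apply, Derivation.smul_apply, ← TensorProduct.smul_tmul',
            map_smul] }) (by
    intro a b i j
    refine derivation_ext_coord fun c k l => ?_
    simp only [LinearMap.coe_mk, AddHom.coe_mk, hH, hρ.leibniz_left, map_add,
      coordEval_inner_left_mul, coordEval_inner_right_mul, Finset.sum_add_distrib]
    simp only [Derivation.add_apply, sum_derivation_apply, Derivation.smul_apply, hH, smul_eq_mul])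
  refine ⟨d, fun a b i j k l => ?_⟩
  rw [hd]
  exact hH a i j b k l

variable {d : Derivation K (RepRing K A n) (Derivation K (RepRing K A n) (RepRing K A n))}

/-- With one argument fixed, both sides are derivations in the other, so generators suffice; this is
applied to each argument in turn. -/
theorem biderivation_skew
    (h : ∀ a b i j k l, d (coord K n a i j) (coord K n b k l) =
      -d (coord K n b k l) (coord K n a i j)) (F G : RepRing K A n) :
    d F G = -d G F := by
  have h1 : ∀ a i j, d (coord K n a i j) = -(evalDerivation (coord K n a i j)).compDer d :=
    fun a i j => derivation_ext_coord fun b k l => h a b i j k l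
  have h2 : d F = -(evalDerivation F).compDer d := derivation_ext_coord fun b k l => by
    have h3 : d (coord K n b k l) F = -d F (coord K n b k l) :=
      DFunLike.congr_fun (h1 b k l) F
    have h4 : (-(evalDerivation F).compDer d) (coord K n b k l) = -d (coord K n b k l) F := rfl
    rw [h4, h3, neg_neg]
  exact DFunLike.congr_fun h2 G

/-- The Jacobiator of a biderivation. -/
def jacobiator (d : Derivation K S (Derivation K S S)) (F G H : S) : S :=
  d F (d G H) + d G (d H F) + d H (d F G)

theorem jacobiator_rotate (d : Derivation K S (Derivation K S S)) (F G H : S) :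
    jacobiator d F G H = jacobiator d G H F := by
  simp only [jacobiator]; ring

/-- A commutator of derivations is a derivation, so this form shows that the Jacobiator is a
derivation in its last argument. -/
theorem jacobiator_eq_derivation {d : Derivation K S (Derivation K S S)}
    (skew : ∀ F G, d F G = -d G F) (F G H : S) :
    jacobiator d F G H = (⁅d F, d G⁆ - d (d F G)) H := by
  rw [Derivation.sub_apply, Derivation.commutator_apply, jacobiator, skew H F, skew H (d F G),
    map_neg]
  ring

/-- Cyclic symmetry brings each argument in turn to the last place, where vanishing on generators
implies vanishing everywhere. -/
theorem jacobiator_eq_zero (skew : ∀ F G, d F G = -d G F)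
    (h : ∀ a b c i j k l p q,
      jacobiator d (coord K n a i j) (coord K n b k l) (coord K n c p q) = 0)
    (F G H : RepRing K A n) : jacobiator d F G H = 0 := by
  have extend : ∀ F G, (∀ c p q, jacobiator d F G (coord K n c p q) = 0) →
      ∀ H, jacobiator d F G H = 0 := by
    intro F G h H
    have h0 : ⁅d F, d G⁆ - d (d F G) = 0 := derivation_ext_coord fun c p q => by
      rw [← jacobiator_eq_derivation skew, h, Derivation.zero_apply]
    rw [jacobiator_eq_derivation skew, h0, Derivation.zero_apply]
  refine extend F G (fun c p q => ?_) H
  rw [jacobiator_rotate, jacobiator_rotate]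
  refine extend _ F (fun b k l => ?_) G
  rw [jacobiator_rotate, jacobiator_rotate]
  exact extend _ _ (fun a i j => by rw [jacobiator_rotate]; exact h _ _ _ _ _ _ _ _ _) F

/-- The two summands are the two terms of the Leibniz rule for a product `x_{pl} y_{kq}`: the
bracket with `x` and, after the flip, the bracket with `y`. -/
theorem apply_coordEval {ρ : A ⊗[K] A →ₗ[K] A ⊗[K] A}
    (hd : ∀ a b i j k l, d (coord K n a i j) (coord K n b k l) =
      coordEval k j i l (ρ (a ⊗ₜ b))) (a : A) (i j k l p q : Fin n) (t : A ⊗[K] A) :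
    d (coord K n a i j) (coordEval p l k q t) =
      tensorEval₃ (coordₗ K p j) (coordₗ K i l) (coordₗ K k q) (extendLeft ρ a t) +
      tensorEval₃ (coordₗ K k j) (coordₗ K i q) (coordₗ K p l)
        (extendLeft ρ a (TensorProduct.comm K A A t)) := by
  induction t with
  | zero => simp
  | tmul x y =>
    simp only [tensorEval_tmul, coordₗ_apply, Derivation.leibniz, hd, smul_eq_mul,
      extendLeft_tmul, tensorEval₃_tmul, TensorProduct.comm_tmul]
    ring
  | add s t hs ht => simp only [map_add, hs, ht]; ring

/-- The bracket induced by a skew-symmetric polyderivation satisfying the double Jacobi identity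
is a Poisson bracket. -/
theorem IsPolyderivation.exists_poissonStructure {ρ : A ⊗[K] A →ₗ[K] A ⊗[K] A}
    (hρ : IsPolyderivation ρ)
    (skew : ∀ a b, ρ (b ⊗ₜ a) = -TensorProduct.comm K A A (ρ (a ⊗ₜ b)))
    (jacobi : ∀ a b c, extendLeft ρ a (ρ (b ⊗ₜ c)) +
      rotate K A (extendLeft ρ b (ρ (c ⊗ₜ a))) +
      rotate K A (rotate K A (extendLeft ρ c (ρ (a ⊗ₜ b)))) = 0) (n : ℕ) :
    ∃ P : PoissonStructure K (RepRing K A n), P.IsInducedBy ρ := by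
  obtain ⟨d, hd⟩ := hρ.exists_biderivation n
  have d_skew : ∀ F G, d F G = -d G F := biderivation_skew fun a b i j k l => by
    rw [hd, hd, skew a b, map_neg, tensorEval_comm, neg_neg]
  have d_jacobi := jacobiator_eq_zero d_skew fun a b c i j k l p q => by
    simp only [jacobiator, hd, apply_coordEval hd]
    have comm : ∀ x y, TensorProduct.comm K A A (ρ (x ⊗ₜ y)) = -ρ (y ⊗ₜ x) := fun x y => by
      rw [skew x y, neg_neg]
    simp only [comm, map_neg]
    -- The six terms of the Jacobiator split by index pattern. Three form the double Jacobi identity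
    -- for `(a,b,c)`; the other three, with a sign from skew-symmetry, form the one for `(a,c,b)`.
    have h1 := congrArg (tensorEval₃ (coordₗ K p j) (coordₗ K i l) (coordₗ K k q)) (jacobi a b c)
    have h2 := congrArg (tensorEval₃ (coordₗ K k j) (coordₗ K i q) (coordₗ K p l)) (jacobi a c b)
    simp only [map_add, tensorEval₃_rotate, map_zero] at h1 h2
    linear_combination h1 - h2
  exact ⟨{
    bracket := LinearMap.mk₂ K (fun F G => d F G) (by simp) (by simp) (by simp) (by simp)
    skew := d_skew
    leibniz := fun F G H => by
      simp only [LinearMap.mk₂_apply, Derivation.leibniz, smul_eq_mul]; ring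
    jacobi := d_jacobi }, hd⟩

end Bracket

/-! ### Base change of the bracket and invariance under conjugation. -/

section Invariance

variable {K : Type u} {A : Type v} [Field K] [Ring A] [Algebra K A] {n : ℕ}

section BaseChange

variable {S : Type*} [CommRing S] [Algebra K S] (P : PoissonStructure K S)
  {R : Type*} [CommRing R] [Algebra K R]

theorem PoissonStructure.baseChange_skew (X Y : R ⊗[K] S) :
    LinearMap.BilinMap.baseChange R P.bracket X Y =
      -LinearMap.BilinMap.baseChange R P.bracket Y X := by
  induction X with
  | zero => simp
  | add X X' h h' => rw [map_add, map_add, LinearMap.add_apply, h, h']; abel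
  | tmul r F =>
    induction Y with
    | zero => simp
    | add Y Y' h h' => rw [map_add, map_add, LinearMap.add_apply, h, h']; abel
    | tmul s G =>
      rw [LinearMap.BilinMap.baseChange_tmul, LinearMap.BilinMap.baseChange_tmul, P.skew F G,
        TensorProduct.tmul_neg, mul_comm]

theorem PoissonStructure.baseChange_leibniz (X Y Z : R ⊗[K] S) :
    LinearMap.BilinMap.baseChange R P.bracket X (Y * Z) =
      LinearMap.BilinMap.baseChange R P.bracket X Y * Z +
        Y * LinearMap.BilinMap.baseChange R P.bracket X Z := by
  induction X with
  | zero => simp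
  | add X X' h h' => simp only [map_add, LinearMap.add_apply, h, h']; ring
  | tmul r F =>
    induction Y with
    | zero => simp
    | add Y Y' h h' => simp only [add_mul, map_add, h, h']; ring
    | tmul s G =>
      induction Z with
      | zero => simp
      | add Z Z' h h' => simp only [mul_add, map_add, h, h']; ring
      | tmul t H =>
        simp only [LinearMap.BilinMap.baseChange_tmul, Algebra.TensorProduct.tmul_mul_tmul,
          P.leibniz, TensorProduct.tmul_add]
        congr 2 <;> ring

/-- A homomorphism which preserves the brackets of generators preserves all brackets. -/
theorem PoissonStructure.map_bracket_of_adjoin {s : Set S} (hs : Algebra.adjoin K s = ⊤)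
    (θ : S →ₐ[K] R ⊗[K] S)
    (h : ∀ F ∈ s, ∀ G ∈ s, θ (P.bracket F G) =
      LinearMap.BilinMap.baseChange R P.bracket (θ F) (θ G)) (F G : S) :
    θ (P.bracket F G) = LinearMap.BilinMap.baseChange R P.bracket (θ F) (θ G) := by
  have extend : ∀ F, (∀ G ∈ s, θ (P.bracket F G) =
      LinearMap.BilinMap.baseChange R P.bracket (θ F) (θ G)) → ∀ G, θ (P.bracket F G) =
      LinearMap.BilinMap.baseChange R P.bracket (θ F) (θ G) := by
    intro F h G
    have hone : P.bracket F 1 = 0 := by simpa using P.leibniz F 1 1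
    have hone' : ∀ X : R ⊗[K] S, LinearMap.BilinMap.baseChange R P.bracket X 1 = 0 := fun X => by
      simpa using P.baseChange_leibniz X 1 1
    have hG : G ∈ Algebra.adjoin K s := hs ▸ Algebra.mem_top
    induction hG using Algebra.adjoin_induction with
    | mem G hG => exact h G hG
    | algebraMap c =>
      rw [Algebra.algebraMap_eq_smul_one, map_smul (P.bracket F), hone, smul_zero, map_zero,
        map_smul θ, map_one, LinearMap.map_smul_of_tower, hone', smul_zero]
    | add G H _ _ hG hH => simp only [map_add, hG, hH]
    | mul G H _ _ hG hH =>
      rw [P.leibniz, map_add, map_mul, map_mul, map_mul, hG, hH, P.baseChange_leibniz]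
  -- Skew-symmetry exchanges the arguments, so the same extension step serves for the first one.
  refine extend F (fun G hG => ?_) G
  rw [P.skew, P.baseChange_skew, map_neg, extend G (fun F hF => h G hG F hF)]

theorem map_mul_map_mul_map_apply (G H : Matrix (Fin n) (Fin n) R) (X : Matrix (Fin n) (Fin n) S)
    (i j : Fin n) :
    (G.map (algebraMap R (R ⊗[K] S)) * X.map (fun x => (1 : R) ⊗ₜ[K] x) *
      H.map (algebraMap R (R ⊗[K] S))) i j =
      ∑ q, ∑ p, (G i p * H q j) ⊗ₜ[K] X p q := by
  simp only [Matrix.mul_apply, Finset.sum_mul, Matrix.map_apply,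
    Algebra.TensorProduct.algebraMap_apply, Algebra.TensorProduct.tmul_mul_tmul, one_mul, mul_one,
    Algebra.algebraMap_self, RingHom.id_apply]

theorem sum_tmul_mul_sum_tmul (G H : Matrix (Fin n) (Fin n) R) (X Y : Matrix (Fin n) (Fin n) S)
    (i j k l : Fin n) :
    (∑ q, ∑ p, (G i p * H q j) ⊗ₜ[K] X p q) * (∑ q, ∑ p, (G k p * H q l) ⊗ₜ[K] Y p q) =
      ∑ s, ∑ r, ∑ q, ∑ p, (G i p * H q j * (G k r * H s l)) ⊗ₜ[K] (X p q * Y r s) := by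
  simp only [Finset.sum_mul, Finset.mul_sum, Algebra.TensorProduct.tmul_mul_tmul]

end BaseChange

variable {R : Type u} [CommRing R] [Algebra K R]

theorem glAct_coord (g : GL (Fin n) R) (a : A) (i j : Fin n) :
    glAct K g (coord K n a i j) =
      ∑ q, ∑ p, (g.1 i p * (g⁻¹).1 q j) ⊗ₜ[K] coord K n a p q := by
  have h : glAct K g (coord K n a i j) = conjRep K
    (Matrix.GeneralLinearGroup.map (algebraMap R (R ⊗[K] RepRing K A n)) g)
    ((Algebra.TensorProduct.includeRight (R := K) (A := R)
      (B := RepRing K A n)).mapMatrix.comp (universalRep K A n)) a i j := by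
    refine (Ideal.Quotient.liftₐ_apply _ _ _ _).trans ?_
    refine (Ideal.Quotient.lift_mk _ _ _).trans ?_
    exact MvPolynomial.aeval_X _ _
  rw [h]
  exact map_mul_map_mul_map_apply g.1 (g⁻¹).1 (fun p q => coord K n a p q) i j

/-- The bracket induced by a linear map `A ⊗ A → A ⊗ A` is invariant under conjugation. -/
theorem PoissonStructure.IsInducedBy.isGLInvariant {P : PoissonStructure K (RepRing K A n)}
    {ρ : A ⊗[K] A →ₗ[K] A ⊗[K] A} (hP : P.IsInducedBy ρ) : P.IsGLInvariant := by
  intro R _ _ g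
  refine P.map_bracket_of_adjoin (adjoin_coord_eq_top K A n) (glAct K g) ?_
  rintro _ ⟨⟨a, i, j⟩, rfl⟩ _ ⟨⟨b, k, l⟩, rfl⟩
  have hP' : ∀ i j k l, P.bracket (coord K n a i j) (coord K n b k l) =
      coordEval k j i l (ρ (a ⊗ₜ b)) := fun i j k l => hP a b i j k l
  simp only [hP', glAct_coord, map_sum, LinearMap.sum_apply, LinearMap.BilinMap.baseChange_tmul]
  generalize ρ (a ⊗ₜ b) = t
  -- Each of the indices `i, j, k, l` carries its own entry of `g` or `g⁻¹` on both sides, so the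
  -- two sums agree after reordering, without any cancellation of `g` against `g⁻¹`.
  have key : ∀ t : A ⊗[K] A, glAct K g (coordEval k j i l t) =
      ∑ s, ∑ p, ∑ q, ∑ r, (g.1 k r * (g⁻¹).1 q j * (g.1 i p * (g⁻¹).1 s l)) ⊗ₜ[K]
        coordEval r q p s t := by
    intro t
    induction t with
    | zero => simp
    | tmul x y =>
      simp only [tensorEval_tmul, coordₗ_apply, map_mul, glAct_coord]
      exact sum_tmul_mul_sum_tmul g.1 (g⁻¹).1 (fun p q => coord K n x p q)
        (fun p q => coord K n y p q) k j i l
    | add s t hs ht => simp only [map_add, TensorProduct.tmul_add, Finset.sum_add_distrib, hs, ht]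
  rw [key]
  refine Finset.sum_congr rfl fun s _ => ?_
  rw [Finset.sum_comm, Finset.sum_congr rfl fun q _ => Finset.sum_comm, Finset.sum_comm]
  refine Finset.sum_congr rfl fun r _ => Finset.sum_congr rfl fun q _ =>
    Finset.sum_congr rfl fun p _ => ?_
  congr 1
  ring

end Invariance

end PreCY

theorem corollary1 {K : Type u} {A : Type v} [Field K] [Ring A] [Algebra K A]
    (m : PreCY.PreCalabiYau K A) (h1 : m.op 1 = 0) (h4 : m.op 4 = 0)
    (ρ : TensorProduct K A A →ₗ[K] TensorProduct K A A)
    (hρ : m.IsRestrictedPolyderivation ρ) (n : ℕ) :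
    ∃ P : PreCY.PoissonStructure K (PreCY.RepRing K A n),
      P.IsInducedBy ρ ∧ P.IsGLInvariant := by
  obtain ⟨P, hP⟩ := hρ.isPolyderivation.exists_poissonStructure
    (fun a b => hρ.corresponds.skew a b) (hρ.corresponds.jacobi h1 h4) n
  exact ⟨P, hP, hP.isGLInvariant⟩
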